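/- Let $S=K[x_1,\dots,x_N]$ be a polynomial ring over a field $K$ with its $\mathbb N^N$-grading, let $I\subseteq S$ be a monomial ideal, and let $m_1,\dots,m_\mu$ be the minimal monomial generators of $I$, listed (without repetition) in a fixed order. The Taylor resolution $(T_\bullet,d_\bullet)$ of $S/I$ has $T_s$ free on the symbols $e_{\ell_1\cdots\ell_s}$, $1\le \ell_1<\cdots<\ell_s\le\mu$ (for $s=0$, on one symbol $e_\emptyset$), where $\deg e_{\ell_1\cdots\ell_s}=\deg\operatorname{lcm}(m_{\ell_1},\dots,m_{\ell_s})\in\mathbb N^N$ and $$d_s(e_{\ell_1\cdots\ell_s})=\sum_{t=1}^{s}(-1)^{t-1}\frac{\operatorname{lcm}(m_{\ell_1},\dots,m_{\ell_s})}{\operatorname{lcm}(m_{\ell_1},\dots,\widehat{m_{\ell_t}},\dots,m_{\ell_s})}\,e_{\ell_1\cdots\widehat{\ell_t}\cdots\ell_s}.$$ The symbol $e_{\ell_1\cdots\ell_s}$ is called $L$-admissible if for all $1\le t<s$ and all $q<\ell_t$ the monomial $m_q$ does not divide $\operatorname{lcm}(m_{\ell_t},\dots,m_{\ell_s})$. An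 $L$-admissible symbol $e_{\ell_1\cdots\ell_s}$ is called maximal if $e_{k_1\cdots k_{s'}}$ is not $L$-admissible whenever $\{\ell_1,\dots,\ell_s\}\subsetneq\{k_1,\dots,k_{s'}\}$. The Lyubeznik resolution $L_\bullet$ of $I$ with respect to the given order is the subcomplex of $T_\bullet$ generated by all $L$-admissible symbols. Proposition 3.1. Let $s\ge 1$, let $e=e_{\ell_1\cdots\ell_s}\in L_s$ be a maximal $L$-admissible symbol, and suppose that there are elements $a_{e'}\in S$, indexed by the $L$-admissible symbols $e'\in L_s$ with $e'\neq e$, such that $$d_s\Bigl(e+\sum_{e'\ne e}a_{e'}\,e'\Bigr)\in(x_1,\dots,x_N)\,L_{s-1}.$$ Put $\sigma=\deg e$. Then $\beta_{s,\sigma}(S/I)\neq0$, where $\beta_{s,\sigma}(S/I)$ is the $\mathbb N^N$-graded Betti number, i.e. the number of summands $S(-\sigma)$ in homological degree $s$ of a minimal $\mathbb N^N$-graded free resolution of $S/I$. -/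

import Mathlib

namespace LyubeznikBetti

open MvPolynomial

/-! Monomials of `S = K[x_1, …, x_N]` are represented by their exponent vectors
`a : Fin N →₀ ℕ`, i.e. by their multidegrees: divisibility is `≤`, least common multiple is `⊔`
(`Finset.sup` for a finite family, with `1 ↔ 0` for the empty family). -/

section Gradings

variable {K : Type*} [Field K] {N : ℕ}

/-- The ideal `(x_1, …, x_N)`. -/
noncomputable def irrelevantIdeal (K : Type*) [Field K] (N : ℕ) : Ideal (MvPolynomial (Fin N) K) :=
  Ideal.span (Set.range X)

/-- `I` is a monomial ideal: it is generated by a set of monomials. -/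
def IsMonomialIdeal (I : Ideal (MvPolynomial (Fin N) K)) : Prop :=
  ∃ A : Set (Fin N →₀ ℕ), I = Ideal.span ((fun a => monomial a (1 : K)) '' A)

/-- The minimal set of monomial generators `G(I)` of a monomial ideal `I`: the monomials of `I`
that are minimal with respect to divisibility. -/
def minimalGenerators (I : Ideal (MvPolynomial (Fin N) K)) : Set (Fin N →₀ ℕ) :=
  {a | Minimal (fun b => monomial b (1 : K) ∈ I) a}

/-- The `ℕ^N`-grading of `S/I` for a monomial ideal `I`: the component of degree `a` is spanned
over `K` by the class of `x^a`. -/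
noncomputable def quotientGrading (I : Ideal (MvPolynomial (Fin N) K)) (a : Fin N →₀ ℕ) :
    Submodule K (MvPolynomial (Fin N) K ⧸ I) :=
  Submodule.span K {Ideal.Quotient.mk I (monomial a (1 : K))}

/-- An `ℕ^N`-graded free resolution
`⋯ → F_2 → F_1 → F_0 → M → 0`, each `F_i` free of finite rank, of an `S`-module `M` with
`ℕ^N`-graded components `𝓜 a`. The module `F_i` is `⨁_j S(-deg i j)`, where the `j`-th basis
vector `Pi.single j 1` is homogeneous of degree `deg i j`; the maps `d i : F_{i+1} → F_i` and
`ε : F_0 → M` preserve degrees. -/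
structure MultigradedFreeResolution {M : Type*} [AddCommGroup M] [Module K M]
    [Module (MvPolynomial (Fin N) K) M] (𝓜 : (Fin N →₀ ℕ) → Submodule K M) where
  rank : ℕ → ℕ
  deg : ∀ i, Fin (rank i) → (Fin N →₀ ℕ)
  d : ∀ i, (Fin (rank (i + 1)) → MvPolynomial (Fin N) K) →ₗ[MvPolynomial (Fin N) K]
    (Fin (rank i) → MvPolynomial (Fin N) K)
  ε : (Fin (rank 0) → MvPolynomial (Fin N) K) →ₗ[MvPolynomial (Fin N) K] M
  /-- The `k`-th coordinate of `d i` of the `j`-th basis vector only involves the monomial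
  `x^a` with `a + deg i k = deg (i + 1) j`. -/
  d_homogeneous : ∀ i (j : Fin (rank (i + 1))) (k : Fin (rank i)),
    ∀ a ∈ (d i (Pi.single j 1) k).support, a + deg i k = deg (i + 1) j
  ε_homogeneous : ∀ j : Fin (rank 0), ε (Pi.single j 1) ∈ 𝓜 (deg 0 j)
  exact_d : ∀ i, Function.Exact (d (i + 1)) (d i)
  exact_ε : Function.Exact (d 0) ε
  surjective_ε : Function.Surjective ε

variable {M : Type*} [AddCommGroup M] [Module K M] [Module (MvPolynomial (Fin N) K) M]
  {𝓜 : (Fin N →₀ ℕ) → Submodule K M}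

/-- The resolution is minimal: `d(F_{i+1}) ⊆ (x_1, …, x_N) F_i` for all `i`. -/
def MultigradedFreeResolution.IsMinimal (F : MultigradedFreeResolution 𝓜) : Prop :=
  ∀ i, LinearMap.range (F.d i) ≤
    irrelevantIdeal K N • (⊤ : Submodule (MvPolynomial (Fin N) K)
      (Fin (F.rank i) → MvPolynomial (Fin N) K))

/-- The number of summands `S(-σ)` of `F_i`. -/
def MultigradedFreeResolution.rankInDegree (F : MultigradedFreeResolution 𝓜) (i : ℕ)
    (σ : Fin N →₀ ℕ) : ℕ :=
  (Finset.univ.filter fun j : Fin (F.rank i) => F.deg i j = σ).card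

/-- The `i`-th `ℕ^N`-graded Betti number `β_{i,σ}(M)` of degree `σ`: the number of summands
`S(-σ)` in homological degree `i` of a minimal `ℕ^N`-graded free resolution of `M`. (All minimal
resolutions give the same number, so the set below has at most one element. In particular
`multigradedBetti 𝓜 i σ ≠ 0` says that a minimal resolution exists and that `S(-σ)` is a summand
of the `i`-th module of each of them.) -/
noncomputable def multigradedBetti (𝓜 : (Fin N →₀ ℕ) → Submodule K M) (i : ℕ)
    (σ : Fin N →₀ ℕ) : ℕ :=
  sInf {n | ∃ F : MultigradedFreeResolution 𝓜, F.IsMinimal ∧ F.rankInDegree i σ = n}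

end Gradings

section Lyubeznik

variable {N μ : ℕ}

/-- The multidegree of the symbol `e_{ℓ_1 ⋯ ℓ_s}`, which is represented by the finite set
`e = {ℓ_1 < ⋯ < ℓ_s}`: the exponent vector of `lcm (m_{ℓ_1}, …, m_{ℓ_s})`. -/
noncomputable def symbolDegree (m : Fin μ → (Fin N →₀ ℕ)) (e : Finset (Fin μ)) : Fin N →₀ ℕ :=
  e.sup m

/-- The symbol `e = {ℓ_1 < ⋯ < ℓ_s}` is `L`-admissible with respect to the order
`m_1, …, m_μ`: for all `t < s` and all `q < ℓ_t`, `m_q` does not divide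
`lcm (m_{ℓ_t}, …, m_{ℓ_s})`. -/
def LAdmissible (m : Fin μ → (Fin N →₀ ℕ)) (e : Finset (Fin μ)) : Prop :=
  ∀ l ∈ e, (∃ l' ∈ e, l < l') → ∀ q < l, ¬ m q ≤ (e.filter fun l' => l ≤ l').sup m

/-- The differential of the Taylor resolution `T = ⨁_s T_s`, where `T` is the free `S`-module on
all symbols (`T_s` being spanned by the symbols with `s` indices, and `T_0 = S e_∅`):
`e_{ℓ_1 ⋯ ℓ_s} ↦ ∑_t (-1)^(t-1) (lcm(e) / lcm(e without ℓ_t)) e_{ℓ_1 ⋯ \hat ℓ_t ⋯ ℓ_s}`. -/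
noncomputable def taylorDifferential (K : Type*) [Field K] (m : Fin μ → (Fin N →₀ ℕ)) :
    (Finset (Fin μ) →₀ MvPolynomial (Fin N) K) →ₗ[MvPolynomial (Fin N) K]
      (Finset (Fin μ) →₀ MvPolynomial (Fin N) K) :=
  Finsupp.linearCombination (MvPolynomial (Fin N) K) fun e =>
    ∑ l ∈ e, Finsupp.single (e.erase l)
      ((-1) ^ (e.filter fun l' => l' < l).card *
        monomial (symbolDegree m e - symbolDegree m (e.erase l)) (1 : K))

/-- The module `L_s` of the Lyubeznik resolution, as a submodule of the Taylor resolution: it is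
generated by the `L`-admissible symbols with `s` indices. Its differential is the one of the
Taylor resolution. -/
noncomputable def lyubeznikModule (K : Type*) [Field K] (m : Fin μ → (Fin N →₀ ℕ)) (s : ℕ) :
    Submodule (MvPolynomial (Fin N) K) (Finset (Fin μ) →₀ MvPolynomial (Fin N) K) :=
  Submodule.span _
    {x | ∃ e : Finset (Fin μ), e.card = s ∧ LAdmissible m e ∧ x = Finsupp.single e 1}

end Lyubeznik

end LyubeznikBetti

namespace LyubeznikBetti

open MvPolynomial

/-! ### The Taylor complex in a fixed multidegree. -/

section Taylor

variable {K : Type*} [Field K] {N μ : ℕ}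

/-! Fix a multidegree `b` and multiply each symbol by the monomial that brings it to degree `b`. The
Taylor differential then becomes a simplicial boundary with coefficients in `K`. If some generator
divides `x^b`, let `q` be the least index of such a generator: adjoining `q` contracts this strand
to zero (`homotopy_symbolMultiple`). Adjoining `q` also keeps symbols `L`-admissible, since no
generator before `m_q` divides `x^b` (`LAdmissible.insert_apex`). So the Lyubeznik complex `L` is a
multigraded free resolution of `S/I`.

Let `F` be any multigraded free resolution of `S/I`. Lifting the identity of `S/I` gives maps `α : L
→ F` and `β : F → L`, with `β` homogeneous, and a homotopy `β α = id + h d + d h'`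
(`IsComparison.exists_succ`). Apply this to `z = e + ∑ a_{e'} e'` and read the constant term of the
coefficient of `e`. The summand `z` gives `1`. The summand `h d z` gives `0`, because `d z` lies in
`(x_1, …, x_N) L`. The summand `d h' z` gives `0`, because a maximal `e` is not a proper face of any
admissible symbol. Hence `β α z` has constant term `1` at `e`, so `β` sends some basis vector of
`F_s` to an element with nonzero constant term at `e`. By homogeneity of `β`, that basis vector has
degree `deg e`. Neither `α` nor `z` needs to be homogeneous.

This covers every resolution, minimal or not. Since the Betti number is an infimum over minimal
resolutions, one must also exist; it is built from iterated syzygies of inclusion-minimal sets of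
homogeneous generators. -/

/-- The multidegree `b` multiple `x^{b - deg e} e` of the symbol `e`. -/
noncomputable def symbolMultiple (K : Type*) [Field K] (m : Fin μ → (Fin N →₀ ℕ))
    (b : Fin N →₀ ℕ) (e : Finset (Fin μ)) : Finset (Fin μ) →₀ MvPolynomial (Fin N) K :=
  Finsupp.single e (monomial (b - symbolDegree m e) 1)

/-- The sign of the face `e \ {l}` in the boundary of `e`. -/
def faceSign (K : Type*) [Field K] (e : Finset (Fin μ)) (l : Fin μ) : K :=
  (-1) ^ (e.filter fun l' => l' < l).card

lemma symbolDegree_mono (m : Fin μ → (Fin N →₀ ℕ)) {e e' : Finset (Fin μ)} (h : e ⊆ e') :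
    symbolDegree m e ≤ symbolDegree m e' :=
  Finset.sup_mono h

lemma taylorDifferential_single (m : Fin μ → (Fin N →₀ ℕ)) (e : Finset (Fin μ))
    (p : MvPolynomial (Fin N) K) :
    taylorDifferential K m (Finsupp.single e p) =
      ∑ l ∈ e, Finsupp.single (e.erase l)
        (p * ((-1) ^ (e.filter fun l' => l' < l).card *
          monomial (symbolDegree m e - symbolDegree m (e.erase l)) (1 : K))) := by
  rw [taylorDifferential, Finsupp.linearCombination_single, Finset.smul_sum]
  refine Finset.sum_congr rfl fun l _ => ?_
  rw [Finsupp.smul_single, smul_eq_mul]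

/-- The quotients of lcms telescope against the normalising monomials, so only the simplicial signs
remain. -/
lemma taylorDifferential_symbolMultiple (m : Fin μ → (Fin N →₀ ℕ)) {b : Fin N →₀ ℕ}
    {e : Finset (Fin μ)} (h : symbolDegree m e ≤ b) :
    taylorDifferential K m (symbolMultiple K m b e) =
      ∑ l ∈ e, faceSign K e l • symbolMultiple K m b (e.erase l) := by
  rw [symbolMultiple, taylorDifferential_single]
  refine Finset.sum_congr rfl fun l _ => ?_
  have h1 := symbolDegree_mono m (Finset.erase_subset l e)
  have h2 : b - symbolDegree m (e.erase l) =
      (b - symbolDegree m e) + (symbolDegree m e - symbolDegree m (e.erase l)) :=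
    (tsub_add_tsub_cancel h h1).symm
  have h3 : ((-1 : MvPolynomial (Fin N) K) ^ (e.filter fun l' => l' < l).card) =
      C (faceSign K e l) := by simp [faceSign]
  rw [symbolMultiple, Finsupp.smul_single, h2, h3, C_mul_monomial, monomial_mul, smul_monomial]
  simp

lemma faceSign_of_forall_ge {e : Finset (Fin μ)} {q : Fin μ} (h : ∀ l ∈ e, q ≤ l) :
    faceSign K e q = 1 := by
  have : (e.filter fun l' => l' < q) = ∅ :=
    Finset.filter_eq_empty_iff.2 fun l hl => not_lt.2 (h l hl)
  simp [faceSign, this]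

lemma faceSign_insert {e : Finset (Fin μ)} {q l : Fin μ} (hq : q ∉ e) (hl : q < l) :
    faceSign K (insert q e) l = - faceSign K e l := by
  have : q ∉ e.filter fun l' => l' < l := fun h => hq (Finset.mem_filter.1 h).1
  rw [faceSign, Finset.filter_insert, if_pos hl, Finset.card_insert_of_notMem this, pow_succ,
    faceSign]
  ring

lemma faceSign_erase_of_lt {e : Finset (Fin μ)} {q l : Fin μ} (hq : q ∈ e) (hl : q < l) :
    faceSign K e l = - faceSign K (e.erase q) l := by
  conv_lhs => rw [← Finset.insert_erase hq]
  exact faceSign_insert (Finset.notMem_erase q e) hl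

lemma faceSign_erase_of_gt {e : Finset (Fin μ)} {q l : Fin μ} (hl : l < q) :
    faceSign K (e.erase q) l = faceSign K e l := by
  have : (e.erase q).filter (fun l' => l' < l) = e.filter fun l' => l' < l := by
    ext x
    simp only [Finset.mem_filter, Finset.mem_erase]
    exact ⟨fun h => ⟨h.1.2, h.2⟩, fun h => ⟨⟨(h.2.trans hl).ne, h.1⟩, h.2⟩⟩
  rw [faceSign, this, faceSign]

/-- Deleting the smaller index first shifts the position of the larger by one; deleting the larger
first leaves the smaller in place. The two orders therefore have opposite signs. -/
lemma faceSign_mul_faceSign {e : Finset (Fin μ)} {l l' : Fin μ} (hl : l ∈ e) (hl' : l' ∈ e)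
    (hne : l ≠ l') :
    faceSign K e l * faceSign K (e.erase l) l' + faceSign K e l' * faceSign K (e.erase l') l =
      0 := by
  rcases hne.lt_or_gt with h | h
  · rw [faceSign_erase_of_gt h, faceSign_erase_of_lt hl h]
    ring
  · rw [faceSign_erase_of_gt h, faceSign_erase_of_lt hl' h]
    ring

lemma single_monomial_eq_symbolMultiple (m : Fin μ → (Fin N →₀ ℕ)) (e : Finset (Fin μ))
    (c : Fin N →₀ ℕ) :
    Finsupp.single e (monomial c (1 : K)) = symbolMultiple K m (c + symbolDegree m e) e := by
  simp [symbolMultiple]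

/-- This reduces `K`-linear statements to single terms, each in its own multidegree. -/
lemma eq_sum_symbolMultiple (m : Fin μ → (Fin N →₀ ℕ))
    (y : Finset (Fin μ) →₀ MvPolynomial (Fin N) K) :
    y = ∑ e ∈ y.support, ∑ c ∈ (y e).support,
      coeff c (y e) • symbolMultiple K m (c + symbolDegree m e) e := by
  conv_lhs => rw [← Finsupp.sum_single y, Finsupp.sum]
  refine Finset.sum_congr rfl fun e _ => ?_
  conv_lhs => rw [(y e).as_sum]
  rw [Finsupp.single_finsetSum]
  refine Finset.sum_congr rfl fun c _ => ?_
  rw [← single_monomial_eq_symbolMultiple, Finsupp.smul_single, smul_monomial]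
  simp

/-- `d ∘ d = 0` in the Taylor complex. -/
lemma taylorDifferential_taylorDifferential (m : Fin μ → (Fin N →₀ ℕ))
    (y : Finset (Fin μ) →₀ MvPolynomial (Fin N) K) :
    taylorDifferential K m (taylorDifferential K m y) = 0 := by
  have key : ∀ e : Finset (Fin μ), taylorDifferential K m
      (taylorDifferential K m (symbolMultiple K m (symbolDegree m e) e)) = 0 := by
    intro e
    set b := symbolDegree m e with hb
    rw [taylorDifferential_symbolMultiple m le_rfl, map_sum]
    have h1 : ∀ l ∈ e, taylorDifferential K m (faceSign K e l • symbolMultiple K m b (e.erase l)) =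
        ∑ l' ∈ e.erase l, (faceSign K e l * faceSign K (e.erase l) l') •
          symbolMultiple K m b ((e.erase l).erase l') := by
      intro l _
      rw [LinearMap.map_smul_of_tower, taylorDifferential_symbolMultiple m
        (symbolDegree_mono m (Finset.erase_subset l e)), Finset.smul_sum]
      exact Finset.sum_congr rfl fun l' _ => smul_smul _ _ _
    rw [Finset.sum_congr rfl h1, Finset.sum_sigma']
    -- The involution exchanges the order in which two indices are deleted.
    refine Finset.sum_involution (fun p _ => ⟨p.2, p.1⟩) ?_ ?_ ?_ ?_
    · rintro ⟨l, l'⟩ h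
      simp only [Finset.mem_sigma, Finset.mem_erase] at h
      dsimp only
      rw [Finset.erase_right_comm (a := l') (b := l), ← add_smul,
        faceSign_mul_faceSign h.1 h.2.2 h.2.1.symm, zero_smul]
    · rintro ⟨l, l'⟩ h _ h'
      simp only [Finset.mem_sigma, Finset.mem_erase] at h
      exact h.2.1 (congrArg Sigma.fst h')
    · rintro ⟨l, l'⟩ h
      simp only [Finset.mem_sigma, Finset.mem_erase] at h ⊢
      exact ⟨h.2.2, h.2.1.symm, h.1⟩
    · rintro ⟨l, l'⟩ h
      rfl
  induction y using Finsupp.induction_linear with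
  | zero => simp
  | add f g hf hg => rw [map_add, map_add, hf, hg, add_zero]
  | single e p =>
    have : Finsupp.single e p = p • symbolMultiple K m (symbolDegree m e) e := by
      simp [symbolMultiple]
    rw [this, map_smul, map_smul, key, smul_zero]

/-- The elements of multidegree `b` of the Taylor complex. -/
def taylorDegree (K : Type*) [Field K] (m : Fin μ → (Fin N →₀ ℕ)) (b : Fin N →₀ ℕ) :
    Submodule K (Finset (Fin μ) →₀ MvPolynomial (Fin N) K) where
  carrier := {y | ∀ e, ∀ c, coeff c (y e) ≠ 0 → c + symbolDegree m e = b}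
  zero_mem' := by simp
  add_mem' := by
    intro x y hx hy e c h
    by_cases h1 : coeff c (x e) = 0
    · refine hy e c fun h2 => h ?_
      simp [h1, h2]
    · exact hx e c h1
  smul_mem' := by
    intro r x hx e c h
    refine hx e c fun h1 => h ?_
    simp [h1]

lemma symbolMultiple_mem_taylorDegree (m : Fin μ → (Fin N →₀ ℕ)) {b : Fin N →₀ ℕ}
    {e : Finset (Fin μ)} (h : symbolDegree m e ≤ b) :
    symbolMultiple K m b e ∈ taylorDegree K m b := by
  intro e' c hc
  rw [symbolMultiple, Finsupp.single_apply] at hc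
  split_ifs at hc with he
  · rw [coeff_monomial] at hc
    split_ifs at hc with hc'
    · rw [← he, ← hc', tsub_add_cancel_of_le h]
    · exact absurd rfl hc
  · simp at hc

lemma smul_mem_taylorDegree {m : Fin μ → (Fin N →₀ ℕ)} {b b' : Fin N →₀ ℕ}
    {p : MvPolynomial (Fin N) K} {y : Finset (Fin μ) →₀ MvPolynomial (Fin N) K}
    (hp : ∀ c ∈ p.support, c + b = b') (hy : y ∈ taylorDegree K m b) :
    p • y ∈ taylorDegree K m b' := by
  classical
  intro e c hc
  rw [Finsupp.smul_apply, smul_eq_mul, coeff_mul] at hc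
  obtain ⟨⟨c₁, c₂⟩, hx, hne⟩ := Finset.exists_ne_zero_of_sum_ne_zero hc
  rw [Finset.HasAntidiagonal.mem_antidiagonal] at hx
  rw [← hx, ← hp c₁ (mem_support_iff.2 (left_ne_zero_of_mul hne)),
    ← hy e c₂ (right_ne_zero_of_mul hne), add_assoc]

/-! ### The cone structure of the strands of the Lyubeznik complex -/

/-- `q` is the least index whose generator divides `x^b`. -/
def IsApex (m : Fin μ → (Fin N →₀ ℕ)) (b : Fin N →₀ ℕ) (q : Fin μ) : Prop :=
  IsLeast {q | m q ≤ b} q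

lemma exists_isApex {m : Fin μ → (Fin N →₀ ℕ)} {b : Fin N →₀ ℕ} {q : Fin μ} (h : m q ≤ b) :
    ∃ q, IsApex m b q := by
  classical
  have hne : (Finset.univ.filter fun q => m q ≤ b).Nonempty := ⟨q, by simpa using h⟩
  have h1 := Finset.isLeast_min' _ hne
  exact ⟨_, by simpa [IsApex] using h1⟩

open scoped Classical in
/-- The contracting homotopy of the Taylor complex: in multidegree `b` it is `e ↦ {q} ∪ e`, where
`q` is the least index such that `m_q` divides `x^b`. -/
noncomputable def coneHomotopy (K : Type*) [Field K] (m : Fin μ → (Fin N →₀ ℕ)) :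
    (Finset (Fin μ) →₀ MvPolynomial (Fin N) K) →ₗ[K]
      (Finset (Fin μ) →₀ MvPolynomial (Fin N) K) :=
  Finsupp.lsum K fun e => (basisMonomials (Fin N) K).constr K fun c =>
    if h : ∃ q, IsApex m (c + symbolDegree m e) q then
      if h.choose ∈ e then 0
      else symbolMultiple K m (c + symbolDegree m e) (insert h.choose e)
    else 0

/-- A least element is unique, so the chosen apex is the given `q`. As the apex varies with the
multidegree, the homotopy is only `K`-linear. -/
lemma coneHomotopy_symbolMultiple {m : Fin μ → (Fin N →₀ ℕ)} {b : Fin N →₀ ℕ}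
    {e : Finset (Fin μ)} (h : symbolDegree m e ≤ b) {q : Fin μ} (hq : IsApex m b q) :
    coneHomotopy K m (symbolMultiple K m b e) =
      if q ∈ e then 0 else symbolMultiple K m b (insert q e) := by
  classical
  have h1 : (monomial (b - symbolDegree m e) (1 : K)) =
      basisMonomials (Fin N) K (b - symbolDegree m e) := rfl
  rw [symbolMultiple, coneHomotopy, Finsupp.lsum_single, h1, Module.Basis.constr_basis]
  have h2 : b - symbolDegree m e + symbolDegree m e = b := tsub_add_cancel_of_le h
  have h3 : ∃ q, IsApex m (b - symbolDegree m e + symbolDegree m e) q := ⟨q, by rwa [h2]⟩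
  have h4 : h3.choose = q := by
    have h5 := h3.choose_spec
    generalize h3.choose = q' at h5
    rw [h2] at h5
    exact h5.unique hq
  rw [dif_pos h3, h4, h2]

lemma coneHomotopy_symbolMultiple_of_not_exists {m : Fin μ → (Fin N →₀ ℕ)} {b : Fin N →₀ ℕ}
    {e : Finset (Fin μ)} (h : symbolDegree m e ≤ b) (hq : ¬ ∃ q, IsApex m b q) :
    coneHomotopy K m (symbolMultiple K m b e) = 0 := by
  classical
  have h1 : (monomial (b - symbolDegree m e) (1 : K)) =
      basisMonomials (Fin N) K (b - symbolDegree m e) := rfl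
  rw [symbolMultiple, coneHomotopy, Finsupp.lsum_single, h1, Module.Basis.constr_basis]
  have h2 : b - symbolDegree m e + symbolDegree m e = b := tsub_add_cancel_of_le h
  rw [dif_neg (by rwa [h2])]

lemma symbolDegree_insert_le {m : Fin μ → (Fin N →₀ ℕ)} {b : Fin N →₀ ℕ}
    {e : Finset (Fin μ)} (h : symbolDegree m e ≤ b) {q : Fin μ} (hq : IsApex m b q) :
    symbolDegree m (insert q e) ≤ b := by
  rw [symbolDegree, Finset.sup_insert]
  exact sup_le hq.1 h

lemma IsApex.le_of_mem {m : Fin μ → (Fin N →₀ ℕ)} {b : Fin N →₀ ℕ}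
    {e : Finset (Fin μ)} (h : symbolDegree m e ≤ b) {q : Fin μ} (hq : IsApex m b q)
    {l : Fin μ} (hl : l ∈ e) : q ≤ l :=
  hq.2 ((Finset.le_sup (f := m) hl).trans h)

/-- Every vertex of `e` is at least `q`, so deleting `q` carries the sign `1`. If `q ∈ e`, the
homotopy kills every face except `e \ {q}`, which it sends back to `e`. If `q ∉ e`, the faces of
`{q} ∪ e` containing `q` cancel against the cones over the faces of `e`, leaving `e`. -/
lemma homotopy_symbolMultiple {m : Fin μ → (Fin N →₀ ℕ)} {b : Fin N →₀ ℕ}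
    {e : Finset (Fin μ)} (h : symbolDegree m e ≤ b) {q : Fin μ} (hq : IsApex m b q) :
    taylorDifferential K m (coneHomotopy K m (symbolMultiple K m b e)) +
      coneHomotopy K m (taylorDifferential K m (symbolMultiple K m b e)) =
      symbolMultiple K m b e := by
  have hle : ∀ l ∈ e, q ≤ l := fun l => hq.le_of_mem h
  have hface : ∀ l, symbolDegree m (e.erase l) ≤ b := fun l =>
    (symbolDegree_mono m (Finset.erase_subset l e)).trans h
  rw [coneHomotopy_symbolMultiple h hq, taylorDifferential_symbolMultiple m h, map_sum]
  simp only [map_smul, coneHomotopy_symbolMultiple (hface _) hq]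
  by_cases hqe : q ∈ e
  · rw [if_pos hqe, map_zero, zero_add, Finset.sum_eq_single q]
    · rw [if_neg (Finset.notMem_erase q e), Finset.insert_erase hqe, faceSign_of_forall_ge hle,
        one_smul]
    · intro l _ hl
      rw [if_pos (Finset.mem_erase.2 ⟨hl.symm, hqe⟩), smul_zero]
    · exact fun h => absurd hqe h
  · rw [if_neg hqe, taylorDifferential_symbolMultiple m (symbolDegree_insert_le h hq),
      Finset.sum_insert hqe, Finset.erase_insert hqe, add_assoc, ← Finset.sum_add_distrib,
      Finset.sum_eq_zero, add_zero, faceSign_of_forall_ge, one_smul]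
    · intro l hl
      rcases Finset.mem_insert.1 hl with rfl | hl
      · exact le_rfl
      · exact hle l hl
    · intro l hl
      have hne : q ≠ l := fun h => hqe (h ▸ hl)
      rw [if_neg fun h => hqe (Finset.mem_of_mem_erase h),
        faceSign_insert hqe (lt_of_le_of_ne (hle l hl) hne), Finset.erase_insert_of_ne hne,
        neg_smul, neg_add_cancel]

/-- A `K`-linear map on the Taylor complex sends `y` into a `K`-subspace if it does so with every
term of `y`. -/
lemma map_mem_of_forall_symbolMultiple {M : Type*} [AddCommGroup M] [Module K M]
    (m : Fin μ → (Fin N →₀ ℕ))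
    (G : (Finset (Fin μ) →₀ MvPolynomial (Fin N) K) →ₗ[K] M) (P : Submodule K M)
    {y : Finset (Fin μ) →₀ MvPolynomial (Fin N) K}
    (hy : ∀ e, ∀ c ∈ (y e).support, G (symbolMultiple K m (c + symbolDegree m e) e) ∈ P) :
    G y ∈ P := by
  rw [eq_sum_symbolMultiple m y, map_sum]
  refine Submodule.sum_mem _ fun e _ => ?_
  rw [map_sum]
  refine Submodule.sum_mem _ fun c hc => ?_
  rw [map_smul]
  exact P.smul_mem _ (hy e c hc)

/-- The homotopy formula, for elements of the Taylor complex all of whose terms lie in multidegrees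
in which the strand of the complex is a cone. -/
lemma homotopy_of_forall_isApex {m : Fin μ → (Fin N →₀ ℕ)}
    {y : Finset (Fin μ) →₀ MvPolynomial (Fin N) K}
    (hy : ∀ e, ∀ c ∈ (y e).support, ∃ q, IsApex m (c + symbolDegree m e) q) :
    taylorDifferential K m (coneHomotopy K m y) +
      coneHomotopy K m (taylorDifferential K m y) = y := by
  let G : (Finset (Fin μ) →₀ MvPolynomial (Fin N) K) →ₗ[K]
      (Finset (Fin μ) →₀ MvPolynomial (Fin N) K) :=
    ((taylorDifferential K m).restrictScalars K) ∘ₗ coneHomotopy K m +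
      coneHomotopy K m ∘ₗ ((taylorDifferential K m).restrictScalars K) - LinearMap.id
  have hG : ∀ x, G x = taylorDifferential K m (coneHomotopy K m x) +
      coneHomotopy K m (taylorDifferential K m x) - x := fun _ => rfl
  have h : G y ∈ (⊥ : Submodule K _) := by
    refine map_mem_of_forall_symbolMultiple m G ⊥ fun e c hc => ?_
    obtain ⟨q, hq⟩ := hy e c hc
    rw [Submodule.mem_bot, hG, homotopy_symbolMultiple le_add_self hq, sub_self]
  rw [Submodule.mem_bot, hG] at h
  exact sub_eq_zero.1 h

lemma coneHomotopy_mem_taylorDegree {m : Fin μ → (Fin N →₀ ℕ)} {b : Fin N →₀ ℕ}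
    {y : Finset (Fin μ) →₀ MvPolynomial (Fin N) K} (hy : y ∈ taylorDegree K m b) :
    coneHomotopy K m y ∈ taylorDegree K m b := by
  refine map_mem_of_forall_symbolMultiple m _ _ fun e c hc => ?_
  have hb := hy e c (mem_support_iff.1 hc)
  have hle : symbolDegree m e ≤ b := hb ▸ le_add_self
  rw [hb]
  by_cases h : ∃ q, IsApex m b q
  · obtain ⟨q, hq⟩ := h
    rw [coneHomotopy_symbolMultiple hle hq]
    split_ifs
    · exact Submodule.zero_mem _
    · exact symbolMultiple_mem_taylorDegree m (symbolDegree_insert_le hle hq)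
  · rw [coneHomotopy_symbolMultiple_of_not_exists hle h]
    exact Submodule.zero_mem _

lemma LAdmissible.subset {m : Fin μ → (Fin N →₀ ℕ)} {e e' : Finset (Fin μ)}
    (h : LAdmissible m e') (hs : e ⊆ e') : LAdmissible m e := by
  rintro l hl ⟨l', hl', hlt⟩ q hq hle
  exact h l (hs hl) ⟨l', hs hl', hlt⟩ q hq
    (hle.trans (Finset.sup_mono (Finset.filter_subset_filter _ hs)))

/-- Since `q` lies at or below all of `e`, the tails starting at other indices do not change. The
tail starting at `q` has lcm dividing `x^b`, and no generator before `m_q` divides that. -/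
lemma LAdmissible.insert_apex {m : Fin μ → (Fin N →₀ ℕ)} {e : Finset (Fin μ)}
    (h : LAdmissible m e) {b : Fin N →₀ ℕ} (hb : symbolDegree m e ≤ b) {q : Fin μ}
    (hq : IsApex m b q) : LAdmissible m (insert q e) := by
  rintro l hl ⟨l', hl', hlt⟩ q' hq' hle
  rcases Finset.mem_insert.1 hl with rfl | hle'
  · refine absurd (hq.2 (hle.trans ((Finset.sup_mono (Finset.filter_subset _ _)).trans
      (symbolDegree_insert_le hb hq)))) (not_le.2 hq')
  · have hql : q ≤ l := hq.le_of_mem hb hle'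
    rcases Finset.mem_insert.1 hl' with rfl | hl''
    · exact absurd hlt (not_lt.2 hql)
    · refine h l hle' ⟨l', hl'', hlt⟩ q' hq' (hle.trans ?_)
      rw [Finset.filter_insert]
      split_ifs with hlq
      · have : q = l := le_antisymm hql hlq
        rw [Finset.insert_eq_self.2]
        simp [this, hle']
      · exact le_rfl

/-! ### The modules of the Lyubeznik complex -/

lemma lyubeznikModule_eq_supported (m : Fin μ → (Fin N →₀ ℕ)) (s : ℕ) :
    lyubeznikModule K m s = Finsupp.supported (MvPolynomial (Fin N) K) (MvPolynomial (Fin N) K)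
      {e : Finset (Fin μ) | e.card = s ∧ LAdmissible m e} := by
  rw [Finsupp.supported_eq_span_single, lyubeznikModule]
  congr 1
  ext x
  constructor
  · rintro ⟨e, h1, h2, rfl⟩
    exact ⟨e, ⟨h1, h2⟩, rfl⟩
  · rintro ⟨e, ⟨h1, h2⟩, rfl⟩
    exact ⟨e, h1, h2, rfl⟩

lemma mem_lyubeznikModule {m : Fin μ → (Fin N →₀ ℕ)} {s : ℕ}
    {y : Finset (Fin μ) →₀ MvPolynomial (Fin N) K} :
    y ∈ lyubeznikModule K m s ↔ ∀ e, y e ≠ 0 → e.card = s ∧ LAdmissible m e := by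
  rw [lyubeznikModule_eq_supported, Finsupp.mem_supported]
  simp [Set.subset_def]

/-- `L_s` is free on the admissible symbols; projectivity is what allows maps out of `L` to be
lifted. -/
instance lyubeznikModule_projective (m : Fin μ → (Fin N →₀ ℕ)) (s : ℕ) :
    Module.Projective (MvPolynomial (Fin N) K) (lyubeznikModule K m s) := by
  rw [lyubeznikModule_eq_supported]
  exact Module.Projective.of_equiv (Finsupp.supportedEquivFinsupp _).symm

lemma symbolMultiple_mem_lyubeznikModule {m : Fin μ → (Fin N →₀ ℕ)} {e : Finset (Fin μ)} {s : ℕ}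
    (h1 : e.card = s) (h2 : LAdmissible m e) (b : Fin N →₀ ℕ) :
    symbolMultiple K m b e ∈ lyubeznikModule K m s := by
  rw [lyubeznikModule_eq_supported]
  exact Finsupp.single_mem_supported _ _ ⟨h1, h2⟩

lemma taylorDifferential_mem_lyubeznikModule {m : Fin μ → (Fin N →₀ ℕ)} {s : ℕ}
    {y : Finset (Fin μ) →₀ MvPolynomial (Fin N) K} (hy : y ∈ lyubeznikModule K m (s + 1)) :
    taylorDifferential K m y ∈ lyubeznikModule K m s := by
  refine map_mem_of_forall_symbolMultiple m ((taylorDifferential K m).restrictScalars K)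
    ((lyubeznikModule K m s).restrictScalars K) fun e c hc => ?_
  obtain ⟨h1, h2⟩ := mem_lyubeznikModule.1 hy e (by rintro h; simp [h] at hc)
  rw [LinearMap.restrictScalars_apply, taylorDifferential_symbolMultiple m le_add_self]
  refine Submodule.sum_mem _ fun l hl => Submodule.smul_mem _ _ ?_
  exact symbolMultiple_mem_lyubeznikModule (by rw [Finset.card_erase_of_mem hl, h1]; rfl)
    (h2.subset (Finset.erase_subset l e)) _

lemma coneHomotopy_mem_lyubeznikModule {m : Fin μ → (Fin N →₀ ℕ)} {s : ℕ}
    {y : Finset (Fin μ) →₀ MvPolynomial (Fin N) K} (hy : y ∈ lyubeznikModule K m s) :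
    coneHomotopy K m y ∈ lyubeznikModule K m (s + 1) := by
  refine map_mem_of_forall_symbolMultiple m (coneHomotopy K m)
    ((lyubeznikModule K m (s + 1)).restrictScalars K) fun e c hc => ?_
  obtain ⟨h1, h2⟩ := mem_lyubeznikModule.1 hy e (by rintro h; simp [h] at hc)
  by_cases h : ∃ q, IsApex m (c + symbolDegree m e) q
  · obtain ⟨q, hq⟩ := h
    rw [coneHomotopy_symbolMultiple le_add_self hq]
    split_ifs with hqe
    · exact Submodule.zero_mem _
    · exact symbolMultiple_mem_lyubeznikModule (by rw [Finset.card_insert_of_notMem hqe, h1])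
        (h2.insert_apex le_add_self hq) _
  · rw [coneHomotopy_symbolMultiple_of_not_exists le_add_self h]
    exact Submodule.zero_mem _

/-- The differential `L_{s+1} → L_s` of the Lyubeznik complex. -/
noncomputable def lyubeznikDifferential (K : Type*) [Field K] (m : Fin μ → (Fin N →₀ ℕ)) (s : ℕ) :
    lyubeznikModule K m (s + 1) →ₗ[MvPolynomial (Fin N) K] lyubeznikModule K m s :=
  (taylorDifferential K m).restrict fun _ => taylorDifferential_mem_lyubeznikModule

@[simp]
lemma coe_lyubeznikDifferential (m : Fin μ → (Fin N →₀ ℕ)) (s : ℕ)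
    (y : lyubeznikModule K m (s + 1)) :
    (lyubeznikDifferential K m s y : Finset (Fin μ) →₀ MvPolynomial (Fin N) K) =
      taylorDifferential K m y := rfl

lemma lyubeznikDifferential_lyubeznikDifferential (m : Fin μ → (Fin N →₀ ℕ)) (s : ℕ)
    (y : lyubeznikModule K m (s + 1 + 1)) :
    lyubeznikDifferential K m s (lyubeznikDifferential K m (s + 1) y) = 0 := by
  ext1
  simp [taylorDifferential_taylorDifferential]

/-- In positive homological degree a symbol has a vertex, whose generator divides the multidegree of
each term; hence an apex always exists. -/
lemma homotopy_lyubeznikModule {m : Fin μ → (Fin N →₀ ℕ)} {s : ℕ}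
    (y : lyubeznikModule K m (s + 1)) :
    taylorDifferential K m (coneHomotopy K m y) + coneHomotopy K m (taylorDifferential K m y) =
      (y : Finset (Fin μ) →₀ MvPolynomial (Fin N) K) := by
  refine homotopy_of_forall_isApex fun e c hc => ?_
  obtain ⟨h, -⟩ := mem_lyubeznikModule.1 y.2 e (by rintro h; simp [h] at hc)
  obtain ⟨l, hl⟩ := Finset.card_pos.1 (show 0 < e.card by omega)
  exact exists_isApex ((Finset.le_sup (f := m) hl).trans le_add_self)

/-- Exactness of the Lyubeznik complex in positive homological degrees. -/
lemma mem_range_lyubeznikDifferential {m : Fin μ → (Fin N →₀ ℕ)} {s : ℕ}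
    (y : lyubeznikModule K m (s + 1)) (hy : lyubeznikDifferential K m s y = 0) :
    y ∈ LinearMap.range (lyubeznikDifferential K m (s + 1)) := by
  refine ⟨⟨coneHomotopy K m y, coneHomotopy_mem_lyubeznikModule y.2⟩, ?_⟩
  ext1
  have h1 : taylorDifferential K m (y : Finset (Fin μ) →₀ MvPolynomial (Fin N) K) = 0 :=
    congrArg Subtype.val hy
  have h2 := homotopy_lyubeznikModule y
  rwa [h1, map_zero, add_zero] at h2

/-- A homogeneous boundary of the Lyubeznik complex is the boundary of a homogeneous element of
the same multidegree. -/
lemma exists_homogeneous_preimage {m : Fin μ → (Fin N →₀ ℕ)} {s : ℕ}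
    {y : lyubeznikModule K m s} (hy : y ∈ LinearMap.range (lyubeznikDifferential K m s))
    {b : Fin N →₀ ℕ}
    (hb : (y : Finset (Fin μ) →₀ MvPolynomial (Fin N) K) ∈ taylorDegree K m b) :
    ∃ x : lyubeznikModule K m (s + 1), lyubeznikDifferential K m s x = y ∧
      (x : Finset (Fin μ) →₀ MvPolynomial (Fin N) K) ∈ taylorDegree K m b := by
  obtain ⟨x, rfl⟩ := hy
  -- Applying `d` to the homotopy formula for `x` shows that the cone over `d x` has boundary `d x`.
  -- Unlike `x`, this cone is homogeneous. The argument also covers `s = 0`.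
  refine ⟨⟨coneHomotopy K m (lyubeznikDifferential K m s x),
    coneHomotopy_mem_lyubeznikModule (lyubeznikDifferential K m s x).2⟩, ?_,
    coneHomotopy_mem_taylorDegree hb⟩
  ext1
  have h := congrArg (taylorDifferential K m) (homotopy_lyubeznikModule x)
  rwa [map_add, taylorDifferential_taylorDifferential, zero_add] at h

end Taylor

/-! ### Comparison of the Lyubeznik resolution with an arbitrary graded free resolution. -/

section Comparison

variable {K : Type*} [Field K] {N μ : ℕ}

lemma mem_irrelevantIdeal {p : MvPolynomial (Fin N) K} :
    p ∈ irrelevantIdeal K N ↔ constantCoeff p = 0 := by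
  have h := mem_ideal_span_X_image (R := K) (s := (Set.univ : Set (Fin N))) (x := p)
  rw [Set.image_univ] at h
  rw [irrelevantIdeal, h, constantCoeff_eq, ← notMem_support_iff]
  constructor
  · intro h0 h1
    obtain ⟨i, -, hi⟩ := h0 0 h1
    exact hi rfl
  · intro h0 c hc
    have hne : c ≠ 0 := fun h => h0 (h ▸ hc)
    obtain ⟨i, hi⟩ := Finsupp.ne_iff.1 hne
    exact ⟨i, trivial, hi⟩

lemma IsMonomialIdeal.mem_iff {I : Ideal (MvPolynomial (Fin N) K)} (hI : IsMonomialIdeal I)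
    {p : MvPolynomial (Fin N) K} : p ∈ I ↔ ∀ c ∈ p.support, monomial c (1 : K) ∈ I := by
  classical
  obtain ⟨A, rfl⟩ := hI
  rw [mem_ideal_span_monomial_image]
  refine forall₂_congr fun c _ => ?_
  rw [mem_ideal_span_monomial_image, support_monomial, if_neg one_ne_zero]
  simp

lemma exists_generator_le {I : Ideal (MvPolynomial (Fin N) K)} {m : Fin μ → (Fin N →₀ ℕ)}
    (hm : Set.range m = minimalGenerators I) {c : Fin N →₀ ℕ} (hc : monomial c (1 : K) ∈ I) :
    ∃ q, m q ≤ c := by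
  obtain ⟨b, hb, hmin⟩ := exists_minimal_le_of_wellFoundedLT
    (fun b => monomial b (1 : K) ∈ I) c hc
  have h : b ∈ minimalGenerators I := hmin
  rw [← hm] at h
  obtain ⟨q, rfl⟩ := h
  exact ⟨q, hb⟩

lemma monomial_generator_mem {I : Ideal (MvPolynomial (Fin N) K)} {m : Fin μ → (Fin N →₀ ℕ)}
    (hm : Set.range m = minimalGenerators I) (q : Fin μ) : monomial (m q) (1 : K) ∈ I := by
  have h : m q ∈ minimalGenerators I := hm ▸ Set.mem_range_self q
  exact h.1

/-- The augmentation `L_0 → S/I`. -/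
noncomputable def augmentation (I : Ideal (MvPolynomial (Fin N) K)) (m : Fin μ → (Fin N →₀ ℕ)) :
    lyubeznikModule K m 0 →ₗ[MvPolynomial (Fin N) K] MvPolynomial (Fin N) K ⧸ I :=
  I.mkQ ∘ₗ Finsupp.lapply ∅ ∘ₗ (lyubeznikModule K m 0).subtype

lemma augmentation_apply (I : Ideal (MvPolynomial (Fin N) K)) (m : Fin μ → (Fin N →₀ ℕ))
    (y : lyubeznikModule K m 0) :
    augmentation I m y =
      Ideal.Quotient.mk I ((y : Finset (Fin μ) →₀ MvPolynomial (Fin N) K) ∅) := rfl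

lemma augmentation_eq_zero_iff {I : Ideal (MvPolynomial (Fin N) K)} {m : Fin μ → (Fin N →₀ ℕ)}
    {y : lyubeznikModule K m 0} : augmentation I m y = 0 ↔
      (y : Finset (Fin μ) →₀ MvPolynomial (Fin N) K) ∅ ∈ I := by
  rw [augmentation_apply, Ideal.Quotient.eq_zero_iff_mem]

/-- The boundary of a one-index symbol `e_q` is `m_q e_∅`, and `m_q` lies in `I`. -/
lemma augmentation_lyubeznikDifferential {I : Ideal (MvPolynomial (Fin N) K)}
    {m : Fin μ → (Fin N →₀ ℕ)} (hm : Set.range m = minimalGenerators I)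
    (y : lyubeznikModule K m (0 + 1)) :
    augmentation I m (lyubeznikDifferential K m 0 y) = 0 := by
  rw [augmentation_eq_zero_iff, coe_lyubeznikDifferential]
  refine map_mem_of_forall_symbolMultiple m
    ((Finsupp.lapply ∅ ∘ₗ taylorDifferential K m).restrictScalars K)
    (I.restrictScalars K) fun e c hc => ?_
  obtain ⟨h1, -⟩ := mem_lyubeznikModule.1 y.2 e (by rintro h; simp [h] at hc)
  obtain ⟨q, rfl⟩ := Finset.card_eq_one.1 h1
  rw [LinearMap.restrictScalars_apply, LinearMap.comp_apply,
    taylorDifferential_symbolMultiple m le_add_self, Finset.sum_singleton,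
    LinearMap.map_smul_of_tower]
  refine Submodule.smul_mem _ _ ?_
  have h2 : ({q} : Finset (Fin μ)).erase q = ∅ := by simp
  have h3 : monomial (c + m q) (1 : K) = monomial c 1 * monomial (m q) 1 := by
    rw [monomial_mul, one_mul]
  rw [h2, symbolMultiple, Finsupp.lapply_apply, Finsupp.single_eq_same]
  simp only [symbolDegree, Finset.sup_singleton, Finset.sup_empty, bot_eq_zero, tsub_zero]
  rw [h3]
  exact I.mul_mem_left _ (monomial_generator_mem hm q)

lemma eq_single_empty {m : Fin μ → (Fin N →₀ ℕ)} (y : lyubeznikModule K m 0) :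
    (y : Finset (Fin μ) →₀ MvPolynomial (Fin N) K) = Finsupp.single ∅
      ((y : Finset (Fin μ) →₀ MvPolynomial (Fin N) K) ∅) := by
  ext1 e
  by_cases he : e = ∅
  · rw [he, Finsupp.single_eq_same]
  · rw [Finsupp.single_eq_of_ne he]
    by_contra h
    exact he (Finset.card_eq_zero.1 (mem_lyubeznikModule.1 y.2 e h).1)

/-- Exactness of the augmented Lyubeznik complex at `L_0`. -/
lemma exists_lyubeznikDifferential_eq_of_augmentation_eq_zero
    {I : Ideal (MvPolynomial (Fin N) K)} (hI : IsMonomialIdeal I)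
    {m : Fin μ → (Fin N →₀ ℕ)} (hm : Set.range m = minimalGenerators I)
    (y : lyubeznikModule K m 0) (hy : augmentation I m y = 0) :
    ∃ x : lyubeznikModule K m (0 + 1), lyubeznikDifferential K m 0 x = y := by
  refine ⟨⟨coneHomotopy K m y, coneHomotopy_mem_lyubeznikModule y.2⟩, ?_⟩
  ext1
  rw [augmentation_eq_zero_iff] at hy
  have h1 : taylorDifferential K m (y : Finset (Fin μ) →₀ MvPolynomial (Fin N) K) = 0 := by
    rw [eq_single_empty y, taylorDifferential_single, Finset.sum_empty]
  -- In homological degree `0` an apex exists exactly because the coefficient of `e_∅` lies in `I`: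
  -- each of its monomials is divisible by a generator.
  have h2 := homotopy_of_forall_isApex (K := K) (m := m) (y := y) ?_
  · rwa [h1, map_zero, add_zero] at h2
  · intro e c hc
    obtain ⟨h3, -⟩ := mem_lyubeznikModule.1 y.2 e (by rintro h; simp [h] at hc)
    rw [Finset.card_eq_zero] at h3
    subst h3
    obtain ⟨q, hq⟩ := exists_generator_le hm (hI.mem_iff.1 hy c hc)
    exact exists_isApex (hq.trans le_self_add)

lemma exists_linearMap_lift {R P A B : Type*} [CommSemiring R] [AddCommMonoid P] [Module R P]
    [Module.Projective R P] [AddCommMonoid A] [Module R A] [AddCommMonoid B] [Module R B]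
    (f : A →ₗ[R] B) (g : P →ₗ[R] B) (h : ∀ x, g x ∈ LinearMap.range f) :
    ∃ k : P →ₗ[R] A, ∀ x, f (k x) = g x := by
  obtain ⟨k, hk⟩ := Module.projective_lifting_property f.rangeRestrict
    (g.codRestrict (LinearMap.range f) h) f.surjective_rangeRestrict
  exact ⟨k, fun x => congrArg Subtype.val (LinearMap.congr_fun hk x)⟩

lemma add_neg_one_smul_self {R A : Type*} [CommRing R] [AddCommMonoid A] [Module R A] (a : A) :
    a + (-1 : R) • a = 0 := by
  calc a + (-1 : R) • a = (1 + (-1) : R) • a := by rw [add_smul, one_smul]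
    _ = 0 := by rw [add_neg_cancel, zero_smul]

lemma eq_add_add_neg_one_smul {R A : Type*} [CommRing R] [AddCommMonoid A] [Module R A] (a b : A) :
    a = b + (a + (-1 : R) • b) := by
  rw [add_left_comm, add_neg_one_smul_self, add_zero]

lemma exists_linearMap_pi_single {R A : Type*} [CommSemiring R] [AddCommMonoid A] [Module R A] {n : ℕ}
    (x : Fin n → A) : ∃ k : (Fin n → R) →ₗ[R] A, ∀ j, k (Pi.single j 1) = x j :=
  ⟨Fintype.linearCombination R x, fun j => by simp⟩

lemma linearMap_pi_apply {R A : Type*} [CommSemiring R] [AddCommMonoid A] [Module R A] {n : ℕ}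
    (f : (Fin n → R) →ₗ[R] A) (y : Fin n → R) : f y = ∑ j, y j • f (Pi.single j 1) := by
  conv_lhs => rw [pi_eq_sum_univ' y, map_sum]
  simp

lemma linearMap_pi_ext {R A : Type*} [CommSemiring R] [AddCommMonoid A] [Module R A] {n : ℕ}
    {f g : (Fin n → R) →ₗ[R] A} (h : ∀ j, f (Pi.single j 1) = g (Pi.single j 1))
    (y : Fin n → R) : f y = g y := by
  rw [linearMap_pi_apply f, linearMap_pi_apply g]
  exact Finset.sum_congr rfl fun j _ => by rw [h]

variable {I : Ideal (MvPolynomial (Fin N) K)}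

/-- Maps `α : L_i → F_i`, `β : F_i → L_i` that are compatible with the boundaries, `β` being
homogeneous, and a homotopy `h` from `β ∘ α` to the identity, on the boundaries of `L_i`. -/
structure IsComparison (m : Fin μ → (Fin N →₀ ℕ))
    (F : MultigradedFreeResolution (quotientGrading I)) (i : ℕ)
    (α : lyubeznikModule K m i →ₗ[MvPolynomial (Fin N) K]
      (Fin (F.rank i) → MvPolynomial (Fin N) K))
    (β : (Fin (F.rank i) → MvPolynomial (Fin N) K) →ₗ[MvPolynomial (Fin N) K]
      lyubeznikModule K m i)
    (h : lyubeznikModule K m i →ₗ[MvPolynomial (Fin N) K] lyubeznikModule K m (i + 1)) : Prop where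
  map_boundary : ∀ x, α (lyubeznikDifferential K m i x) ∈ LinearMap.range (F.d i)
  map_boundary' : ∀ y, β (F.d i y) ∈ LinearMap.range (lyubeznikDifferential K m i)
  homogeneous : ∀ j, (β (Pi.single j 1) : Finset (Fin μ) →₀ MvPolynomial (Fin N) K) ∈
    taylorDegree K m (F.deg i j)
  homotopy : ∀ x, β (α (lyubeznikDifferential K m i x)) = lyubeznikDifferential K m i x +
    lyubeznikDifferential K m i (h (lyubeznikDifferential K m i x))

lemma exists_isComparison_zero (hI : IsMonomialIdeal I)
    {m : Fin μ → (Fin N →₀ ℕ)} (hm : Set.range m = minimalGenerators I)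
    (F : MultigradedFreeResolution (quotientGrading I)) :
    ∃ α β h, IsComparison m F 0 α β h := by
  obtain ⟨α, hα⟩ := exists_linearMap_lift F.ε (augmentation I m)
    (fun x => F.surjective_ε _)
  have hlift : ∀ j : Fin (F.rank 0), ∃ x : lyubeznikModule K m 0,
      augmentation I m x = F.ε (Pi.single j 1) ∧
      (x : Finset (Fin μ) →₀ MvPolynomial (Fin N) K) ∈ taylorDegree K m (F.deg 0 j) := by
    intro j
    obtain ⟨r, hr⟩ := Submodule.mem_span_singleton.1 (F.ε_homogeneous j)
    have hmem : symbolMultiple K m (F.deg 0 j) ∅ ∈ lyubeznikModule K m 0 :=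
      symbolMultiple_mem_lyubeznikModule rfl (fun l hl => absurd hl (Finset.notMem_empty l)) _
    refine ⟨⟨r • symbolMultiple K m (F.deg 0 j) ∅,
      ((lyubeznikModule K m 0).restrictScalars K).smul_mem r hmem⟩, ?_, ?_⟩
    · rw [augmentation_apply, ← hr]
      simp only [symbolMultiple, Finsupp.smul_apply, Finsupp.single_eq_same, symbolDegree,
        Finset.sup_empty, bot_eq_zero, tsub_zero]
      rfl
    · exact Submodule.smul_mem _ _ (symbolMultiple_mem_taylorDegree m (by simp [symbolDegree]))
  choose b hb hdeg using hlift
  obtain ⟨β, hβ⟩ := exists_linearMap_pi_single (R := MvPolynomial (Fin N) K) b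
  have hβ' : ∀ y, augmentation I m (β y) = F.ε y :=
    linearMap_pi_ext (f := augmentation I m ∘ₗ β) (g := F.ε) fun j => by
      rw [LinearMap.comp_apply, hβ, hb]
  let G : lyubeznikModule K m 0 →ₗ[MvPolynomial (Fin N) K] lyubeznikModule K m 0 :=
    -- The map `β α - id` lands in the kernel of the augmentation, hence lifts through `d` to the
    -- first homotopy.
    β ∘ₗ α + (-1 : MvPolynomial (Fin N) K) • LinearMap.id
  have hG : ∀ x, G x = β (α x) + (-1 : MvPolynomial (Fin N) K) • x := fun _ => rfl
  have hG' : ∀ x, augmentation I m (G x) = 0 := fun x => by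
    rw [hG, map_add, map_smul, hβ', hα, add_neg_one_smul_self]
  obtain ⟨h, hh⟩ := exists_linearMap_lift (lyubeznikDifferential K m 0) G
    (fun x => exists_lyubeznikDifferential_eq_of_augmentation_eq_zero hI hm _ (hG' x))
  refine ⟨α, β, h, ?_, ?_, ?_, ?_⟩
  · intro x
    refine (F.exact_ε _).1 ?_
    rw [hα, augmentation_lyubeznikDifferential hm]
  · intro y
    refine exists_lyubeznikDifferential_eq_of_augmentation_eq_zero hI hm _ ?_
    rw [hβ']
    exact (F.exact_ε _).2 ⟨y, rfl⟩
  · intro j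
    rw [hβ]
    exact hdeg j
  · intro x
    rw [hh, hG]
    exact eq_add_add_neg_one_smul _ _

/-- The inductive step of the comparison theorem. Recording the homotopy only on boundaries makes
the term `h d` of the previous stage vanish by `d d = 0`, so the induction needs no data from two
stages back. -/
lemma IsComparison.exists_succ {m : Fin μ → (Fin N →₀ ℕ)}
    {F : MultigradedFreeResolution (quotientGrading I)} {i : ℕ}
    {α : lyubeznikModule K m i →ₗ[MvPolynomial (Fin N) K]
      (Fin (F.rank i) → MvPolynomial (Fin N) K)}
    {β : (Fin (F.rank i) → MvPolynomial (Fin N) K) →ₗ[MvPolynomial (Fin N) K]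
      lyubeznikModule K m i}
    {h : lyubeznikModule K m i →ₗ[MvPolynomial (Fin N) K] lyubeznikModule K m (i + 1)}
    (H : IsComparison m F i α β h) :
    ∃ α' β' h', IsComparison m F (i + 1) α' β' h' ∧
      ∀ x, β' (α' x) = x + h (lyubeznikDifferential K m i x) +
        lyubeznikDifferential K m (i + 1) (h' x) := by
  obtain ⟨α', hα⟩ := exists_linearMap_lift (F.d i) (α ∘ₗ lyubeznikDifferential K m i)
    H.map_boundary
  have hlift : ∀ j : Fin (F.rank (i + 1)), ∃ x : lyubeznikModule K m (i + 1),
      lyubeznikDifferential K m i x = β (F.d i (Pi.single j 1)) ∧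
      (x : Finset (Fin μ) →₀ MvPolynomial (Fin N) K) ∈ taylorDegree K m (F.deg (i + 1) j) := by
    intro j
    have hdeg : (β (F.d i (Pi.single j 1)) : Finset (Fin μ) →₀ MvPolynomial (Fin N) K) ∈
        taylorDegree K m (F.deg (i + 1) j) := by
      rw [linearMap_pi_apply β]
      simp only [Submodule.coe_sum, Submodule.coe_smul]
      exact Submodule.sum_mem _ fun k _ =>
        smul_mem_taylorDegree (F.d_homogeneous i j k) (H.homogeneous k)
    -- Choosing homogeneous preimages of the basis vectors' images is what keeps `β'` homogeneous.
    exact exists_homogeneous_preimage (H.map_boundary' _) hdeg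
  choose b hb hdeg using hlift
  obtain ⟨β', hβ⟩ := exists_linearMap_pi_single (R := MvPolynomial (Fin N) K) b
  have hβ' : ∀ y, lyubeznikDifferential K m i (β' y) = β (F.d i y) :=
    linearMap_pi_ext (f := lyubeznikDifferential K m i ∘ₗ β') (g := β ∘ₗ F.d i) fun j => by
      rw [LinearMap.comp_apply, hβ, hb, LinearMap.comp_apply]
  have hα' : ∀ x, F.d i (α' x) = α (lyubeznikDifferential K m i x) := hα
  let G : lyubeznikModule K m (i + 1) →ₗ[MvPolynomial (Fin N) K] lyubeznikModule K m (i + 1) :=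
    -- The defect `β' α' - id - h d` takes values in cycles, which are boundaries by exactness;
    -- lifting it gives `h'`.
    β' ∘ₗ α' + (-1 : MvPolynomial (Fin N) K) •
      (LinearMap.id + h ∘ₗ lyubeznikDifferential K m i)
  have hG : ∀ x, G x = β' (α' x) + (-1 : MvPolynomial (Fin N) K) •
      (x + h (lyubeznikDifferential K m i x)) := fun _ => rfl
  have hG' : ∀ x, lyubeznikDifferential K m i (G x) = 0 := fun x => by
    rw [hG, map_add, map_smul, map_add, hβ', hα', H.homotopy, add_neg_one_smul_self]
  obtain ⟨h', hh⟩ := exists_linearMap_lift (lyubeznikDifferential K m (i + 1)) G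
    (fun x => mem_range_lyubeznikDifferential _ (hG' x))
  have hh' : ∀ x, β' (α' x) = x + h (lyubeznikDifferential K m i x) +
      lyubeznikDifferential K m (i + 1) (h' x) := fun x => by
    rw [hh, hG]
    exact eq_add_add_neg_one_smul _ _
  refine ⟨α', β', h', ⟨?_, ?_, ?_, ?_⟩, hh'⟩
  · intro x
    refine (F.exact_d i _).1 ?_
    rw [hα', lyubeznikDifferential_lyubeznikDifferential, map_zero]
  · intro y
    refine mem_range_lyubeznikDifferential _ ?_
    rw [hβ', (F.exact_d i _).2 ⟨y, rfl⟩, map_zero]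
  · intro j
    rw [hβ]
    exact hdeg j
  · intro x
    rw [hh', lyubeznikDifferential_lyubeznikDifferential, map_zero, add_zero]

lemma exists_isComparison (hI : IsMonomialIdeal I)
    {m : Fin μ → (Fin N →₀ ℕ)} (hm : Set.range m = minimalGenerators I)
    (F : MultigradedFreeResolution (quotientGrading I)) (i : ℕ) :
    ∃ α β h, IsComparison m F i α β h := by
  induction i with
  | zero => exact exists_isComparison_zero hI hm F
  | succ i ih =>
    obtain ⟨α, β, h, H⟩ := ih
    obtain ⟨α', β', h', H', -⟩ := H.exists_succ
    exact ⟨α', β', h', H'⟩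

/-- The coefficient of a maximal admissible symbol in a boundary is zero. -/
lemma lyubeznikDifferential_apply_of_maximal {m : Fin μ → (Fin N →₀ ℕ)} {s : ℕ}
    {e : Finset (Fin μ)} (he : Maximal (LAdmissible m) e) (x : lyubeznikModule K m (s + 1)) :
    (lyubeznikDifferential K m s x : Finset (Fin μ) →₀ MvPolynomial (Fin N) K) e = 0 := by
  rw [coe_lyubeznikDifferential]
  refine map_mem_of_forall_symbolMultiple m
    ((Finsupp.lapply e ∘ₗ taylorDifferential K m).restrictScalars K)
    (⊥ : Submodule K _) fun e' c hc => ?_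
  obtain ⟨-, h1⟩ := mem_lyubeznikModule.1 x.2 e' (by rintro h; simp [h] at hc)
  rw [LinearMap.restrictScalars_apply, LinearMap.comp_apply,
    taylorDifferential_symbolMultiple m le_add_self, map_sum]
  refine Submodule.sum_mem _ fun l hl => ?_
  rw [LinearMap.map_smul_of_tower, symbolMultiple, Finsupp.lapply_apply,
    Finsupp.single_eq_of_ne, smul_zero]
  · exact Submodule.zero_mem _
  · rintro rfl
    -- If `e = e' \ {l}` with `e'` admissible, maximality forces `e' ⊆ e`, so `l ∈ e' \ {l}`.
    exact Finset.notMem_erase l e' (he.2 h1 (Finset.erase_subset l e') hl)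

/-- An `S`-linear map carries `(x_1, …, x_N) L_s` into `(x_1, …, x_N) L_t`; no homogeneity of `h` is
needed. -/
lemma constantCoeff_apply_of_mem_smul {m : Fin μ → (Fin N →₀ ℕ)} {s t : ℕ}
    (h : lyubeznikModule K m s →ₗ[MvPolynomial (Fin N) K] lyubeznikModule K m t)
    {x : lyubeznikModule K m s}
    (hx : (x : Finset (Fin μ) →₀ MvPolynomial (Fin N) K) ∈
      irrelevantIdeal K N • lyubeznikModule K m s) (e : Finset (Fin μ)) :
    constantCoeff ((h x : Finset (Fin μ) →₀ MvPolynomial (Fin N) K) e) = 0 := by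
  rw [← Submodule.mem_smul_top_iff] at hx
  induction hx using Submodule.smul_induction_on' with
  | smul r hr y _ =>
    rw [map_smul, Submodule.coe_smul, Finsupp.smul_apply, smul_eq_mul, map_mul,
      mem_irrelevantIdeal.1 hr, zero_mul]
  | add y _ z _ hy hz => rw [map_add, Submodule.coe_add, Finsupp.add_apply, map_add, hy, hz, add_zero]

/-- A chain of the Lyubeznik complex with constant coefficient `1` at the maximal admissible
symbol `e`, whose boundary vanishes modulo `(x_1, …, x_N)`, forces a summand `S(-deg e)` in every
free resolution. -/
lemma exists_deg_eq_of_maximal (hI : IsMonomialIdeal I)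
    {m : Fin μ → (Fin N →₀ ℕ)} (hm : Set.range m = minimalGenerators I)
    (F : MultigradedFreeResolution (quotientGrading I)) {s : ℕ}
    {e : Finset (Fin μ)} (he : Maximal (LAdmissible m) e) (z : lyubeznikModule K m (s + 1))
    (hz : constantCoeff ((z : Finset (Fin μ) →₀ MvPolynomial (Fin N) K) e) = 1)
    (hdz : taylorDifferential K m z ∈ irrelevantIdeal K N • lyubeznikModule K m s) :
    ∃ j, F.deg (s + 1) j = symbolDegree m e := by
  obtain ⟨α, β, h, H⟩ := exists_isComparison hI hm F s
  obtain ⟨α', β', h', H', hh⟩ := H.exists_succ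
  have h1 : constantCoeff ((β' (α' z) : Finset (Fin μ) →₀ MvPolynomial (Fin N) K) e) = 1 := by
    rw [hh, Submodule.coe_add, Submodule.coe_add, Finsupp.add_apply, Finsupp.add_apply,
      lyubeznikDifferential_apply_of_maximal he, map_add, map_add, hz,
      constantCoeff_apply_of_mem_smul h hdz]
    simp
  rw [linearMap_pi_apply β'] at h1
  simp only [Submodule.coe_sum, Submodule.coe_smul, Finsupp.finsetSum_apply, map_sum,
    Finsupp.smul_apply, smul_eq_mul, map_mul] at h1
  obtain ⟨j, -, hj⟩ := Finset.exists_ne_zero_of_sum_ne_zero (h1.trans_ne one_ne_zero)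
  refine ⟨j, ?_⟩
  -- A nonzero coefficient of `x^0` at `e` leaves no room for a shift between the two degrees.
  have h3 := H'.homogeneous j e 0 (right_ne_zero_of_mul hj)
  rw [← h3, zero_add]

end Comparison

/-! ### Graded free modules and existence of minimal graded free resolutions. -/

section MinimalResolution

variable {K : Type*} [Field K] {N : ℕ}

lemma mem_irrelevantIdeal_smul_top {n : ℕ} {y : Fin n → MvPolynomial (Fin N) K}
    (h : ∀ j, constantCoeff (y j) = 0) :
    y ∈ irrelevantIdeal K N • (⊤ : Submodule (MvPolynomial (Fin N) K)
      (Fin n → MvPolynomial (Fin N) K)) := by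
  rw [pi_eq_sum_univ' y]
  exact Submodule.sum_mem _ fun j _ =>
    Submodule.smul_mem_smul (mem_irrelevantIdeal.2 (h j)) trivial

/-- The elements of multidegree `b` of the graded free module `⨁_k S(-deg k)`. -/
def freeDegree {n : ℕ} (K : Type*) [Field K] (deg : Fin n → (Fin N →₀ ℕ)) (b : Fin N →₀ ℕ) :
    Submodule K (Fin n → MvPolynomial (Fin N) K) where
  carrier := {y | ∀ k, ∀ c, coeff c (y k) ≠ 0 → c + deg k = b}
  zero_mem' := by simp
  add_mem' := by
    intro x y hx hy e c h
    by_cases h1 : coeff c (x e) = 0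
    · refine hy e c fun h2 => h ?_
      simp [h1, h2]
    · exact hx e c h1
  smul_mem' := by
    intro r x hx e c h
    refine hx e c fun h1 => h ?_
    simp [h1]

lemma smul_mem_freeDegree {n : ℕ} {deg : Fin n → (Fin N →₀ ℕ)} {b b' : Fin N →₀ ℕ}
    {p : MvPolynomial (Fin N) K} {y : Fin n → MvPolynomial (Fin N) K}
    (hp : ∀ c, coeff c p ≠ 0 → c + b = b') (hy : y ∈ freeDegree K deg b) :
    p • y ∈ freeDegree K deg b' := by
  classical
  intro k c hc
  rw [Pi.smul_apply, smul_eq_mul, coeff_mul] at hc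
  obtain ⟨⟨c₁, c₂⟩, hx, hne⟩ := Finset.exists_ne_zero_of_sum_ne_zero hc
  rw [Finset.HasAntidiagonal.mem_antidiagonal] at hx
  rw [← hx, ← hp c₁ (left_ne_zero_of_mul hne), ← hy k c₂ (right_ne_zero_of_mul hne), add_assoc]

open scoped Classical in
/-- The component of multidegree `b` of an element of `⨁_k S(-deg k)`. -/
noncomputable def component {n : ℕ} (K : Type*) [Field K] (deg : Fin n → (Fin N →₀ ℕ))
    (b : Fin N →₀ ℕ) :
    (Fin n → MvPolynomial (Fin N) K) →ₗ[K] (Fin n → MvPolynomial (Fin N) K) :=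
  LinearMap.pi fun k => if deg k ≤ b then
    monomial (b - deg k) ∘ₗ lcoeff K (b - deg k) ∘ₗ LinearMap.proj k else 0

open scoped Classical in
lemma coeff_component {n : ℕ} (deg : Fin n → (Fin N →₀ ℕ)) (b : Fin N →₀ ℕ)
    (y : Fin n → MvPolynomial (Fin N) K) (k : Fin n) (c : Fin N →₀ ℕ) :
    coeff c (component K deg b y k) = if c + deg k = b then coeff c (y k) else 0 := by
  rw [component, LinearMap.pi_apply]
  split_ifs with h1 h2 h2
  · have : b - deg k = c := by rw [← h2, add_tsub_cancel_right]
    simp [this]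
  · have : b - deg k ≠ c := by
      rintro rfl
      exact h2 (tsub_add_cancel_of_le h1)
    simp [coeff_monomial, this]
  · exact absurd (h2 ▸ le_add_self) h1
  · simp

lemma component_mem_freeDegree {n : ℕ} (deg : Fin n → (Fin N →₀ ℕ)) (b : Fin N →₀ ℕ)
    (y : Fin n → MvPolynomial (Fin N) K) : component K deg b y ∈ freeDegree K deg b := by
  classical
  intro k c hc
  rw [coeff_component] at hc
  by_contra h
  exact hc (if_neg h)

lemma component_of_mem {n : ℕ} {deg : Fin n → (Fin N →₀ ℕ)} {b : Fin N →₀ ℕ}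
    {y : Fin n → MvPolynomial (Fin N) K} (hy : y ∈ freeDegree K deg b) :
    component K deg b y = y := by
  classical
  ext k c
  rw [coeff_component]
  split_ifs with h
  · rfl
  · by_contra h'
    exact h (hy k c (Ne.symm h'))

lemma component_of_mem_of_ne {n : ℕ} {deg : Fin n → (Fin N →₀ ℕ)} {b b' : Fin N →₀ ℕ}
    {y : Fin n → MvPolynomial (Fin N) K} (hy : y ∈ freeDegree K deg b') (h : b' ≠ b) :
    component K deg b y = 0 := by
  classical
  ext k c
  rw [coeff_component]
  split_ifs with hc
  · by_contra h'
    exact h ((hy k c h').symm.trans hc)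
  · simp

open scoped Classical in
-- Only finitely many multidegrees occur in `y`. Allowing every larger `B'` lets a prescribed degree
-- be added to the sum.
lemma exists_sum_component_eq {n : ℕ} (deg : Fin n → (Fin N →₀ ℕ))
    (y : Fin n → MvPolynomial (Fin N) K) :
    ∃ B : Finset (Fin N →₀ ℕ), ∀ B', B ⊆ B' → ∑ b ∈ B', component K deg b y = y := by
  refine ⟨Finset.univ.biUnion fun k => (y k).support.image fun c => c + deg k, fun B' hB => ?_⟩
  ext k c
  rw [Finset.sum_apply, coeff_sum]
  simp only [coeff_component]
  rw [Finset.sum_ite_eq]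
  split_ifs with h
  · rfl
  · by_contra h'
    refine h (hB (Finset.mem_biUnion.2 ⟨k, Finset.mem_univ k, Finset.mem_image.2 ⟨c, ?_, rfl⟩⟩))
    exact mem_support_iff.2 (Ne.symm h')

/-- A homogeneous homomorphism of degree `0` of graded free modules. -/
def IsHomogeneousMap {n n' : ℕ} (deg : Fin n → (Fin N →₀ ℕ)) (deg' : Fin n' → (Fin N →₀ ℕ))
    (g : (Fin n' → MvPolynomial (Fin N) K) →ₗ[MvPolynomial (Fin N) K]
      (Fin n → MvPolynomial (Fin N) K)) : Prop :=
  ∀ j, g (Pi.single j 1) ∈ freeDegree K deg (deg' j)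

section

variable {n n' : ℕ} {deg : Fin n → (Fin N →₀ ℕ)} {deg' : Fin n' → (Fin N →₀ ℕ)}
  {g : (Fin n' → MvPolynomial (Fin N) K) →ₗ[MvPolynomial (Fin N) K]
    (Fin n → MvPolynomial (Fin N) K)}

lemma IsHomogeneousMap.map_mem (hg : IsHomogeneousMap deg deg' g) {b : Fin N →₀ ℕ}
    {y : Fin n' → MvPolynomial (Fin N) K} (hy : y ∈ freeDegree K deg' b) :
    g y ∈ freeDegree K deg b := by
  rw [linearMap_pi_apply g]
  exact Submodule.sum_mem _ fun j _ => smul_mem_freeDegree (hy j) (hg j)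

lemma IsHomogeneousMap.map_component (hg : IsHomogeneousMap deg deg' g) (b : Fin N →₀ ℕ)
    (y : Fin n' → MvPolynomial (Fin N) K) :
    g (component K deg' b y) = component K deg b (g y) := by
  classical
  obtain ⟨B, hB⟩ := exists_sum_component_eq deg' y
  conv_rhs => rw [← hB (insert b B) (Finset.subset_insert b B), map_sum, map_sum]
  rw [Finset.sum_eq_single b]
  · exact (component_of_mem (hg.map_mem (component_mem_freeDegree deg' b y))).symm
  · intro b' _ hne
    exact component_of_mem_of_ne (hg.map_mem (component_mem_freeDegree deg' b' y)) hne
  · intro h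
    exact absurd (Finset.mem_insert_self b B) h

end

/-- A graded submodule of a graded free module of finite rank. -/
structure GradedSubmodule (K : Type*) [Field K] (N : ℕ) where
  rank : ℕ
  deg : Fin rank → (Fin N →₀ ℕ)
  carrier : Submodule (MvPolynomial (Fin N) K) (Fin rank → MvPolynomial (Fin N) K)
  component_mem : ∀ y ∈ carrier, ∀ b, component K deg b y ∈ carrier

/-- By noetherianity there are finitely many generators; their homogeneous components stay in the
submodule and generate it. -/
lemma GradedSubmodule.exists_homogeneous_generators (U : GradedSubmodule K N) :
    ∃ t : Finset (Fin U.rank → MvPolynomial (Fin N) K),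
      (∀ y ∈ t, ∃ b, y ∈ freeDegree K U.deg b) ∧
      Submodule.span (MvPolynomial (Fin N) K) (t : Set (Fin U.rank → MvPolynomial (Fin N) K)) =
        U.carrier := by
  classical
  obtain ⟨s, hs⟩ : U.carrier.FG := IsNoetherian.noetherian _
  choose B hB using fun y : Fin U.rank → MvPolynomial (Fin N) K => exists_sum_component_eq U.deg y
  refine ⟨s.biUnion fun y => (B y).image fun b => component K U.deg b y, ?_, ?_⟩
  · intro x hx
    obtain ⟨y, -, hx⟩ := Finset.mem_biUnion.1 hx
    obtain ⟨b, -, rfl⟩ := Finset.mem_image.1 hx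
    exact ⟨b, component_mem_freeDegree U.deg b y⟩
  · apply le_antisymm
    · rw [Submodule.span_le]
      intro x hx
      obtain ⟨y, hy, hx⟩ := Finset.mem_biUnion.1 (Finset.mem_coe.1 hx)
      obtain ⟨b, -, rfl⟩ := Finset.mem_image.1 hx
      exact U.component_mem y (hs ▸ Submodule.subset_span hy) b
    · conv_lhs => rw [← hs]
      rw [Submodule.span_le]
      intro y hy
      rw [SetLike.mem_coe, ← hB y (B y) subset_rfl]
      refine Submodule.sum_mem _ fun b hb => Submodule.subset_span ?_
      exact Finset.mem_coe.2 (Finset.mem_biUnion.2 ⟨y, hy, Finset.mem_image.2 ⟨b, hb, rfl⟩⟩)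

/-- A graded submodule of a graded free module is minimally covered by a graded free module. -/
lemma GradedSubmodule.exists_minimal_cover (U : GradedSubmodule K N) :
    ∃ (V : GradedSubmodule K N)
      (g : (Fin V.rank → MvPolynomial (Fin N) K) →ₗ[MvPolynomial (Fin N) K]
        (Fin U.rank → MvPolynomial (Fin N) K)),
      IsHomogeneousMap U.deg V.deg g ∧ LinearMap.range g = U.carrier ∧
      LinearMap.ker g = V.carrier ∧ V.carrier ≤ irrelevantIdeal K N • ⊤ := by
  classical
  -- A generating set minimal under inclusion suffices: if a relation had a coefficient with nonzero
  -- constant term, the corresponding generator would be redundant.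
  obtain ⟨t, ⟨ht, hspan⟩, hmin⟩ := exists_minimal_of_wellFoundedLT
    (fun t : Finset (Fin U.rank → MvPolynomial (Fin N) K) =>
      (∀ y ∈ t, ∃ b, y ∈ freeDegree K U.deg b) ∧
      Submodule.span (MvPolynomial (Fin N) K) (t : Set (Fin U.rank → MvPolynomial (Fin N) K)) =
        U.carrier) U.exists_homogeneous_generators
  let x : Fin t.card → (Fin U.rank → MvPolynomial (Fin N) K) := fun j => t.equivFin.symm j
  have hx : ∀ j, x j ∈ t := fun j => (t.equivFin.symm j).2
  have hxinj : Function.Injective x := Subtype.val_injective.comp t.equivFin.symm.injective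
  have hxrange : Set.range x = t := by
    ext y
    constructor
    · rintro ⟨j, rfl⟩
      exact hx j
    · intro hy
      exact ⟨t.equivFin ⟨y, hy⟩, by simp [x]⟩
  choose deg' hdeg' using fun j => ht (x j) (hx j)
  let g : (Fin t.card → MvPolynomial (Fin N) K) →ₗ[MvPolynomial (Fin N) K]
    (Fin U.rank → MvPolynomial (Fin N) K) := Fintype.linearCombination (MvPolynomial (Fin N) K) x
  have hgx : ∀ j, g (Pi.single j 1) = x j := fun j => by simp [g]
  have hg : IsHomogeneousMap U.deg deg' g := fun j => by
    rw [hgx]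
    exact hdeg' j
  refine ⟨⟨t.card, deg', LinearMap.ker g, ?_⟩, g, hg, ?_, rfl, ?_⟩
  · intro y hy b
    rw [LinearMap.mem_ker] at hy ⊢
    rw [hg.map_component, hy, map_zero]
  · rw [Fintype.range_linearCombination, hxrange, hspan]
  · intro y hy
    rw [LinearMap.mem_ker] at hy
    refine mem_irrelevantIdeal_smul_top fun j => ?_
    by_contra hr
    -- The component in the degree of the `j`-th generator is again a relation. Its `j`-th
    -- coordinate is just the nonzero constant, hence a unit, so `x j` can be solved for.
    set w := component K deg' (deg' j) y with hw
    have hgw : g w = 0 := by rw [hg.map_component, hy, map_zero]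
    have hwj : w j = C (constantCoeff (y j)) := by
      ext c
      rw [hw, coeff_component, coeff_C]
      by_cases hc : c = 0
      · simp [hc, constantCoeff_eq]
      · rw [if_neg (by simpa using hc), if_neg (Ne.symm hc)]
    have hrel : w j • x j + ∑ k ∈ Finset.univ.erase j, w k • x k = 0 := by
      have hsum := linearMap_pi_apply g w
      simp only [hgx, hgw] at hsum
      rw [Finset.add_sum_erase _ (fun k => w k • x k) (Finset.mem_univ j), ← hsum]
    have hrest : ∑ k ∈ Finset.univ.erase j, w k • x k ∈
        Submodule.span (MvPolynomial (Fin N) K)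
          ((t.erase (x j) : Finset _) : Set (Fin U.rank → MvPolynomial (Fin N) K)) := by
      refine Submodule.sum_mem _ fun k hk => Submodule.smul_mem _ _ (Submodule.subset_span ?_)
      refine Finset.mem_coe.2 (Finset.mem_erase.2 ⟨fun h => ?_, hx k⟩)
      exact (Finset.mem_erase.1 hk).1 (hxinj h)
    have hxj : x j ∈ Submodule.span (MvPolynomial (Fin N) K)
        ((t.erase (x j) : Finset _) : Set (Fin U.rank → MvPolynomial (Fin N) K)) := by
      have h1 : x j = (C (-(constantCoeff (y j))⁻¹) : MvPolynomial (Fin N) K) •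
          ∑ k ∈ Finset.univ.erase j, w k • x k := by
        have h2 : x j = (C (constantCoeff (y j))⁻¹ : MvPolynomial (Fin N) K) • w j • x j := by
          rw [hwj, smul_smul, ← C_mul, inv_mul_cancel₀ hr, C_1, one_smul]
        rw [eq_neg_of_add_eq_zero_left hrel, smul_neg] at h2
        rw [C_neg, neg_smul]
        exact h2
      have h2 := Submodule.smul_mem _ (C (-(constantCoeff (y j))⁻¹)) hrest
      rwa [← h1] at h2
    have hle : t ≤ t.erase (x j) := hmin ⟨fun y hy => ht y (Finset.mem_of_mem_erase hy), by
      rw [← hspan]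
      refine le_antisymm (Submodule.span_mono (Finset.coe_subset.2 (Finset.erase_subset _ _))) ?_
      rw [Submodule.span_le]
      intro y hy
      by_cases h : y = x j
      · rw [h]
        exact hxj
      · exact Submodule.subset_span (Finset.mem_coe.2 (Finset.mem_erase.2 ⟨h, hy⟩))⟩
      (Finset.erase_subset _ _)
    exact Finset.notMem_erase _ _ (hle (hx j))

/-- The graded submodule of relations between the elements of a minimal set of homogeneous
generators of `U`. -/
noncomputable def GradedSubmodule.syzygy (U : GradedSubmodule K N) : GradedSubmodule K N :=
  U.exists_minimal_cover.choose

/-- The minimal cover of a graded submodule by a graded free module. -/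
noncomputable def GradedSubmodule.cover (U : GradedSubmodule K N) :
    (Fin U.syzygy.rank → MvPolynomial (Fin N) K) →ₗ[MvPolynomial (Fin N) K]
      (Fin U.rank → MvPolynomial (Fin N) K) :=
  U.exists_minimal_cover.choose_spec.choose

lemma GradedSubmodule.cover_spec (U : GradedSubmodule K N) :
    IsHomogeneousMap U.deg U.syzygy.deg U.cover ∧ LinearMap.range U.cover = U.carrier ∧
      LinearMap.ker U.cover = U.syzygy.carrier ∧
      U.syzygy.carrier ≤ irrelevantIdeal K N • ⊤ :=
  U.exists_minimal_cover.choose_spec.choose_spec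

/-- The iterated modules of syzygies of `U`. -/
noncomputable def GradedSubmodule.syzygies (U : GradedSubmodule K N) : ℕ → GradedSubmodule K N
  | 0 => U
  | i + 1 => (U.syzygies i).syzygy

variable {M : Type*} [AddCommGroup M] [Module K M] [Module (MvPolynomial (Fin N) K) M]
  {𝓜 : (Fin N →₀ ℕ) → Submodule K M}

/-- A minimal presentation `F_0 → M` extends to a minimal graded free resolution. -/
lemma exists_isMinimal_of_ker (U : GradedSubmodule K N)
    (ε : (Fin U.rank → MvPolynomial (Fin N) K) →ₗ[MvPolynomial (Fin N) K] M)
    (hε : ∀ j, ε (Pi.single j 1) ∈ 𝓜 (U.deg j)) (hsurj : Function.Surjective ε)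
    (hker : LinearMap.ker ε = U.carrier) (hmin : U.carrier ≤ irrelevantIdeal K N • ⊤) :
    ∃ F : MultigradedFreeResolution 𝓜, F.IsMinimal := by
  refine ⟨⟨fun i => (U.syzygies i).rank, fun i => (U.syzygies i).deg,
    fun i => (U.syzygies i).cover, ε, ?_, hε, ?_, ?_, hsurj⟩, ?_⟩
  · intro i j k c hc
    exact (U.syzygies i).cover_spec.1 j k c (mem_support_iff.1 hc)
  · intro i y
    exact SetLike.ext_iff.1 ((U.syzygies i).cover_spec.2.2.1.trans
      (U.syzygies (i + 1)).cover_spec.2.1.symm) y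
  · intro y
    exact SetLike.ext_iff.1 (hker.trans U.cover_spec.2.1.symm) y
  · intro i
    refine ((U.syzygies i).cover_spec.2.1).trans_le ?_
    cases i with
    | zero => exact hmin
    | succ i => exact (U.syzygies i).cover_spec.2.2.2

/-- The map `S^n → S/I` that sends every basis vector to `1`. -/
noncomputable def sumMap (I : Ideal (MvPolynomial (Fin N) K)) (n : ℕ) :
    (Fin n → MvPolynomial (Fin N) K) →ₗ[MvPolynomial (Fin N) K] MvPolynomial (Fin N) K ⧸ I :=
  I.mkQ ∘ₗ Fintype.linearCombination (MvPolynomial (Fin N) K) fun _ => 1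

lemma sumMap_apply (I : Ideal (MvPolynomial (Fin N) K)) (n : ℕ)
    (y : Fin n → MvPolynomial (Fin N) K) :
    sumMap I n y = Ideal.Quotient.mk I (∑ j, y j) := by
  rw [sumMap, LinearMap.comp_apply, Fintype.linearCombination_apply]
  simp only [smul_eq_mul, mul_one]
  rfl

lemma mem_ker_sumMap {I : Ideal (MvPolynomial (Fin N) K)} {n : ℕ}
    {y : Fin n → MvPolynomial (Fin N) K} :
    y ∈ LinearMap.ker (sumMap I n) ↔ ∑ j, y j ∈ I := by
  rw [LinearMap.mem_ker, sumMap_apply, Ideal.Quotient.eq_zero_iff_mem]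

/-- With all basis vectors in degree `0`, taking a component extracts one monomial from every
coordinate, and a monomial ideal contains each term of its elements. -/
lemma component_mem_ker_sumMap {I : Ideal (MvPolynomial (Fin N) K)} (hI : IsMonomialIdeal I)
    {n : ℕ} {y : Fin n → MvPolynomial (Fin N) K} (hy : y ∈ LinearMap.ker (sumMap I n))
    (b : Fin N →₀ ℕ) :
    component K (fun _ : Fin n => (0 : Fin N →₀ ℕ)) b y ∈ LinearMap.ker (sumMap I n) := by
  classical
  rw [mem_ker_sumMap] at hy ⊢
  rw [hI.mem_iff]
  intro c hc
  refine hI.mem_iff.1 hy c (mem_support_iff.2 fun h => mem_support_iff.1 hc ?_)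
  rw [coeff_sum] at h ⊢
  simp only [coeff_component]
  split_ifs
  · exact h
  · simp

/-- A monomial ideal has a minimal multigraded free resolution. -/
lemma exists_isMinimal {I : Ideal (MvPolynomial (Fin N) K)} (hI : IsMonomialIdeal I) :
    ∃ F : MultigradedFreeResolution (quotientGrading I), F.IsMinimal := by
  have key : ∀ n : ℕ, Function.Surjective (sumMap I n) →
      LinearMap.ker (sumMap I n) ≤ irrelevantIdeal K N • ⊤ →
      ∃ F : MultigradedFreeResolution (quotientGrading I), F.IsMinimal := by
    intro n hsurj hmin
    refine exists_isMinimal_of_ker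
      ⟨n, fun _ => 0, LinearMap.ker (sumMap I n), fun y => component_mem_ker_sumMap hI⟩
      (sumMap I n) (fun j => ?_) hsurj rfl hmin
    rw [sumMap_apply, Finset.sum_pi_single']
    rw [if_pos (Finset.mem_univ _)]
    exact Submodule.mem_span_singleton_self (R := K) (Ideal.Quotient.mk I (monomial 0 1))
  -- If `I = S` the quotient is zero and minimality requires `F_0 = 0`. Otherwise `F_0 = S`, and a
  -- proper monomial ideal contains no polynomial with nonzero constant term.
  by_cases htop : I = ⊤
  · refine key 0 ?_ fun y _ => mem_irrelevantIdeal_smul_top fun j => j.elim0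
    have := Ideal.Quotient.subsingleton_iff.2 htop
    exact fun x => ⟨0, Subsingleton.elim _ _⟩
  · refine key 1 ?_ fun y hy => mem_irrelevantIdeal_smul_top fun j => ?_
    · intro x
      obtain ⟨p, rfl⟩ := Ideal.Quotient.mk_surjective x
      exact ⟨fun _ => p, by rw [sumMap_apply]; simp⟩
    · rw [mem_ker_sumMap, Fin.sum_univ_one] at hy
      rw [Subsingleton.elim j 0]
      by_contra h
      rw [constantCoeff_eq] at h
      exact htop ((Ideal.eq_top_iff_one I).2 (hI.mem_iff.1 hy 0 (mem_support_iff.2 h)))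

end MinimalResolution

end LyubeznikBetti

/-! ### Nonvanishing of the Betti number. -/

open LyubeznikBetti in
open scoped Classical in
theorem proposition3p1 {K : Type*} [Field K] {N μ : ℕ}
    (I : Ideal (MvPolynomial (Fin N) K)) (hI : IsMonomialIdeal I)
    (m : Fin μ → (Fin N →₀ ℕ)) (hm_inj : Function.Injective m)
    (hm_range : Set.range m = minimalGenerators I)
    (s : ℕ) (hs : 1 ≤ s)
    (e : Finset (Fin μ)) (he_card : e.card = s) (he_max : Maximal (LAdmissible m) e)
    (a : Finset (Fin μ) → MvPolynomial (Fin N) K)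
    (h : taylorDifferential K m
        (Finsupp.single e 1 +
          ∑ e' ∈ Finset.univ.filter
              (fun e' : Finset (Fin μ) => e'.card = s ∧ LAdmissible m e' ∧ e' ≠ e),
            a e' • Finsupp.single e' 1) ∈
      irrelevantIdeal K N • lyubeznikModule K m (s - 1)) :
    multigradedBetti (quotientGrading I) s (symbolDegree m e) ≠ 0 := by
  obtain ⟨s, rfl⟩ : ∃ s', s = s' + 1 := ⟨s - 1, (Nat.sub_add_cancel hs).symm⟩
  have hmem : ∀ e' : Finset (Fin μ), e'.card = s + 1 → LAdmissible m e' →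
      Finsupp.single e' (1 : MvPolynomial (Fin N) K) ∈ lyubeznikModule K m (s + 1) :=
    fun e' h1 h2 => Submodule.subset_span ⟨e', h1, h2, rfl⟩
  have hz : Finsupp.single e 1 + ∑ e' ∈ Finset.univ.filter
      (fun e' : Finset (Fin μ) => e'.card = s + 1 ∧ LAdmissible m e' ∧ e' ≠ e),
      a e' • Finsupp.single e' 1 ∈ lyubeznikModule K m (s + 1) := by
    refine Submodule.add_mem _ (hmem e he_card he_max.1) (Submodule.sum_mem _ fun e' he' => ?_)
    obtain ⟨-, h1, h2, -⟩ := Finset.mem_filter.1 he'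
    exact Submodule.smul_mem _ _ (hmem e' h1 h2)
  have hcoeff : (Finsupp.single e (1 : MvPolynomial (Fin N) K) + ∑ e' ∈ Finset.univ.filter
      (fun e' : Finset (Fin μ) => e'.card = s + 1 ∧ LAdmissible m e' ∧ e' ≠ e),
      a e' • Finsupp.single e' (1 : MvPolynomial (Fin N) K)) e = 1 := by
    rw [Finsupp.add_apply, Finsupp.single_eq_same, Finsupp.finsetSum_apply,
      Finset.sum_eq_zero, add_zero]
    intro e' he'
    rw [Finsupp.smul_apply, Finsupp.single_eq_of_ne (Finset.mem_filter.1 he').2.2.2.symm,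
      smul_zero]
  -- An infimum in `ℕ` is `0` also for the empty set, so two things are needed: no minimal
  -- resolution has rank `0` in this degree, and a minimal resolution exists.
  rw [multigradedBetti, Ne, Nat.sInf_eq_zero, not_or]
  constructor
  · rintro ⟨F, -, hF⟩
    obtain ⟨j, hj⟩ := exists_deg_eq_of_maximal hI hm_range F he_max ⟨_, hz⟩
      (by rw [hcoeff, map_one]) h
    rw [MultigradedFreeResolution.rankInDegree, Finset.card_eq_zero] at hF
    exact Finset.notMem_empty j (hF ▸ Finset.mem_filter.2 ⟨Finset.mem_univ j, hj⟩)
  · obtain ⟨F, hF⟩ := exists_isMinimal hI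
    exact Set.Nonempty.ne_empty ⟨_, F, hF, rfl⟩
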